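/- Let $p$ be a prime, $n\ge 1$, $q=p^n$, and let $I_q$ be the set of monic irreducible polynomials in $\mathbb F_q[x]$. An $F$-set is a subset $A\subseteq I_q$ such that for every $f\in A$ all monic irreducible divisors of $f(x)-f(0)$ lie in $A$; it is called non-trivial if $A\ne I_q$. The nullity of $A$ is $N(A)=\{f\in A: f(x)\nmid g(x)-g(0)\text{ for all } g\in A\}$. Put $A_0=A$ and $A_m=A_{m-1}\setminus N(A_{m-1})$ for $m\ge 1$. The width $w(A)\in\mathbb N\cup\{\infty\}$ is the least $m\ge 0$ such that $A_m$ is finite, and $w(A)=\infty$ if there is no such $m$. (a) If $q\neq 2,3$, there exists a non-trivial $F$-set of width exactly $2$ in $\mathbb F_q[x]$. More precisely, there are a prime $l\mid q-1$ and elements $\alpha,\beta\in\mathbb F_q$, neither of which is an $l$-th power in $\mathbb F_q$, such that $f=x^2+\alpha x+\beta$ is irreducible and $$\{x\}\cup\{x^{l^k}+\alpha : k\ge 0\}\cup\{f(x^{l^k}) : k\ge 0\}$$ is a non-trivial $F$-set of width $2$. (b) There exists a non-trivial $F$-set of infinite width in $\mathbb F_q[x]$ in each of the following cases: (i) $p\equiv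 2$ or $5 \pmod 9$ and $n=1$; (ii) $p\equiv 5\pmod 8$ and $n$ is odd; (iii) $q\equiv 3\pmod 4$. In this case the set of all monic irreducible divisors of the polynomials $x^{2^k}-a$, with $k\ge 0$ and $a\in\mathbb F_q$, is such an $F$-set. -/

import Mathlib

open Polynomial

section FSets

variable {F : Type*} [Field F]

/-- The set of all monic irreducible polynomials over `F`. -/
def monicIrreducibles (F : Type*) [Field F] : Set F[X] :=
  {f | f.Monic ∧ Irreducible f}

/-- `A` is an `F`-set: a set of monic irreducible polynomials such that, for every `f ∈ A`, all
monic irreducible divisors of `f(x) - f(0)` lie in `A`. -/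
def IsFSet (A : Set F[X]) : Prop :=
  A ⊆ monicIrreducibles F ∧
    ∀ f ∈ A, ∀ g ∈ monicIrreducibles F, g ∣ f - C (f.eval 0) → g ∈ A

/-- The nullity of `A`: the elements of `A` that divide no `g(x) - g(0)` with `g ∈ A`. -/
def nullity (A : Set F[X]) : Set F[X] :=
  {f | f ∈ A ∧ ∀ g ∈ A, ¬ f ∣ g - C (g.eval 0)}

/-- The nullity filtration `A₀ = A`, `Aₙ₊₁ = Aₙ \ N(Aₙ)`. -/
def nullityFiltration (A : Set F[X]) : ℕ → Set F[X]
  | 0 => A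
  | n + 1 => nullityFiltration A n \ nullity (nullityFiltration A n)

/-- The width of `A`: the least `n` such that `Aₙ` is finite, and `⊤` if there is none. -/
noncomputable def fWidth (A : Set F[X]) : ℕ∞ :=
  ⨅ (n : ℕ) (_ : (nullityFiltration A n).Finite), (n : ℕ∞)

/-- The polynomial `x² + αx + β`. -/
noncomputable def quadPoly (α β : F) : F[X] := X ^ 2 + C α * X + C β

/-- The set `{x} ∪ {x^(l^k) + α : k ≥ 0} ∪ {f(x^(l^k)) : k ≥ 0}`, where `f = x² + αx + β`. -/
def quadPowerSet (l : ℕ) (α β : F) : Set F[X] :=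
  {X} ∪ {g | ∃ k : ℕ, g = X ^ l ^ k + C α} ∪
    {g | ∃ k : ℕ, g = (quadPoly α β).comp (X ^ l ^ k)}

/-- All monic irreducible divisors of the polynomials `x^(2^k) - a`, for `k ≥ 0` and `a ∈ F`. -/
def twoPowerDivisors (F : Type*) [Field F] : Set F[X] :=
  {f | f ∈ monicIrreducibles F ∧ ∃ (k : ℕ) (a : F), f ∣ X ^ 2 ^ k - C a}

end FSets

universe u

/-! For h = x² + αx + β and n ≥ 1, h(xⁿ) - h(0) = xⁿ(xⁿ + α). So membership of h(xⁿ) forces x and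
the factors of xⁿ + α, and nothing more. What must be controlled is irreducibility after
substituting x^(l^k). It holds when a root of h is not an l-th power in its own field (with -1 a
square there if l = 2), which a norm computation detects through β.

(a) If neither α nor β is an l-th power, all members are irreducible. The first nullity is the layer
h(x^(l^k)), the second the layer x^(l^k) + α, and {x} remains.

(b) Here the nullity is empty and the set infinite, so the filtration is constant. The sets are: (i)
the quadratics x² ± x + 1 in x^(3^k), linked by Y³ - ε = (Y - ε)(Y² + εY + 1) for ε² = 1; (ii) the
iterates Pₙ of x² - 2, linked by Pₙ₊₂ - 2 = (Pₙ₊₁ - 2)Pₙ²; (iii) the divisors of x^(2^k) - a, each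
linear or a quadratic in a 2-power of x. Properness follows because no member has degree 3. -/

/-! ### Irreducibility after substituting a prime power of x -/

theorem X_pow_prime_pow_sub_C_irreducible {K : Type u} [Field K] {l : ℕ} (hl : l.Prime)
    (hi : l ≠ 2 ∨ IsSquare (-1 : K)) {a : K} (ha : ∀ b : K, b ^ l ≠ a) (k : ℕ) :
    Irreducible (X ^ l ^ k - C a) := by
  by_cases h2 : l = 2
  swap
  · exact X_pow_sub_C_irreducible_of_prime_pow hl h2 k ha
  subst h2
  replace hi : IsSquare (-1 : K) := by simpa using hi
  induction k generalizing K a with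
  | zero => simpa using irreducible_X_sub_C a
  | succ k ih =>
    rw [pow_succ]
    apply X_pow_mul_sub_C_irreducible (X_pow_sub_C_irreducible_of_prime hl ha)
    intro E _ _ x hx
    have hint : IsIntegral K x := not_not.mp fun h ↦ by
      simpa only [degree_zero, degree_X_pow_sub_C hl.pos,
        WithBot.natCast_ne_bot] using congr_arg degree (hx.symm.trans (dif_neg h))
    refine ih (fun b hb => ?_) ?_
    -- Here x² = a and N(x) = -a. If x = b², then N(b)² = -a, and i² = -1 makes a = (i N(b))² a
    -- square in K.
    · obtain ⟨i, hi⟩ := hi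
      have hN : Algebra.norm K b ^ 2 = -a := by
        rw [← map_pow, hb, ← IntermediateField.adjoin.powerBasis_gen hint,
          Algebra.PowerBasis.norm_gen_eq_coeff_zero_minpoly]
        simp [IntermediateField.minpoly_gen, hx]
      apply ha (i * Algebra.norm K b)
      rw [mul_pow, hN, sq, ← hi]; ring
    · simpa using hi.map (algebraMap K (IntermediateField.adjoin K {x}))

theorem irreducible_comp_X_pow_prime_pow {K : Type u} [Field K] {l : ℕ} (hl : l.Prime)
    {f : K[X]} (hfm : f.Monic) (hf : Irreducible f)
    (h : ∀ (E : Type u) [Field E] [Algebra K E] (x : E) (_ : minpoly K x = f),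
      (l ≠ 2 ∨ IsSquare (-1 : IntermediateField.adjoin K {x})) ∧
      ∀ b : IntermediateField.adjoin K {x}, b ^ l ≠ IntermediateField.AdjoinSimple.gen K x)
    (k : ℕ) : Irreducible (f.comp (X ^ l ^ k)) := by
  refine irreducible_comp hfm (monic_X_pow _) hf fun E _ _ x hx => ?_
  simpa using X_pow_prime_pow_sub_C_irreducible hl (h E x hx).1 (h E x hx).2 k

theorem finite_field_natCard_adjoin {K : Type u} [Field K] [Finite K] {E : Type u} [Field E]
    [Algebra K E] {x : E} (hx : IsIntegral K x) :
    Finite (IntermediateField.adjoin K {x}) ∧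
    Nat.card (IntermediateField.adjoin K {x}) = Nat.card K ^ (minpoly K x).natDegree := by
  have := IntermediateField.adjoin.finiteDimensional hx
  have hfin : Finite (IntermediateField.adjoin K {x}) := Module.finite_of_finite K
  refine ⟨hfin, ?_⟩
  rw [Module.natCard_eq_pow_finrank (K := K), IntermediateField.adjoin.finrank hx]

theorem isIntegral_of_minpoly_eq {K E : Type*} [Field K] [Field E] [Algebra K E] {x : E}
    {f : K[X]} (hf : f ≠ 0) (hx : minpoly K x = f) : IsIntegral K x := by
  by_contra h
  exact hf (hx ▸ minpoly.eq_zero h)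

/-- A root x of f has norm (-1)^deg f · f(0), so an l-th root of x in K(x) would have as norm an
l-th root of this scalar in K. When deg f is even, |K(x)| is a perfect square, hence not 3 mod 4,
and -1 is a square in K(x). -/
theorem irreducible_comp_of_coeff_zero {K : Type u} [Field K] [Finite K] {l : ℕ} (hl : l.Prime)
    {f : K[X]} (hfm : f.Monic) (hf : Irreducible f)
    (hi : l ≠ 2 ∨ IsSquare (-1 : K) ∨ Even f.natDegree)
    (h : ∀ b : K, b ^ l ≠ (-1) ^ f.natDegree * f.coeff 0) (k : ℕ) :
    Irreducible (f.comp (X ^ l ^ k)) := by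
  refine irreducible_comp_X_pow_prime_pow hl hfm hf (fun E _ _ x hx => ⟨?_, fun b hb => ?_⟩) k
  · rcases hi with hi | hi | hi
    · exact .inl hi
    · right
      simpa using hi.map (algebraMap K (IntermediateField.adjoin K {x}))
    · right
      obtain ⟨hfin, hcard⟩ :=
        finite_field_natCard_adjoin (isIntegral_of_minpoly_eq hf.ne_zero hx)
      have := Fintype.ofFinite (IntermediateField.adjoin K {x})
      rw [FiniteField.isSquare_neg_one_iff, Fintype.card_eq_nat_card, hcard, hx]
      obtain ⟨d, hd⟩ := hi
      rw [hd, ← two_mul, pow_mul, Nat.pow_mod]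
      have : Nat.card K ^ 2 % 4 = 0 ∨ Nat.card K ^ 2 % 4 = 1 := by
        rw [Nat.pow_mod]
        have := Nat.mod_lt (Nat.card K) (show 0 < 4 by norm_num)
        interval_cases Nat.card K % 4 <;> simp
      rcases this with h | h <;> rw [h]
      · rcases Nat.eq_zero_or_pos d with rfl | hd
        · simp
        · simp [hd.ne']
      · simp
  · have hint := isIntegral_of_minpoly_eq hf.ne_zero hx
    apply h (Algebra.norm K b)
    rw [← map_pow, hb, ← IntermediateField.adjoin.powerBasis_gen hint,
      Algebra.PowerBasis.norm_gen_eq_coeff_zero_minpoly]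
    simp [IntermediateField.minpoly_gen, hx]

/-! ### Generalities on F-sets, width and properness -/

theorem eq_of_mem_monicIrreducibles_of_dvd {F : Type*} [Field F] {f g : F[X]}
    (hg : g ∈ monicIrreducibles F) (hf : f ∈ monicIrreducibles F) (h : g ∣ f) : g = f :=
  eq_of_monic_of_associated hg.1 hf.1 (hg.2.associated_of_dvd hf.2 h)

theorem X_mem_monicIrreducibles {F : Type*} [Field F] : (X : F[X]) ∈ monicIrreducibles F :=
  ⟨monic_X, irreducible_X⟩

theorem eq_X_of_dvd_X_pow {F : Type*} [Field F] {g : F[X]} {n : ℕ}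
    (hg : g ∈ monicIrreducibles F) (h : g ∣ X ^ n) : g = X :=
  eq_of_mem_monicIrreducibles_of_dvd hg X_mem_monicIrreducibles (hg.2.prime.dvd_of_dvd_pow h)

theorem fWidth_eq_top {F : Type*} [Field F] {A : Set F[X]} (hA : A.Infinite)
    (h : nullity A = ∅) : fWidth A = ⊤ := by
  have key : ∀ n, nullityFiltration A n = A := by
    intro n
    induction n with
    | zero => rfl
    | succ n ih => rw [nullityFiltration, ih, h, Set.sdiff_empty]
  simp [fWidth, key, hA]

theorem exists_monicIrreducibles_natDegree {F : Type*} [Field F] [Finite F] (n : ℕ) [NeZero n] :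
    ∃ f ∈ monicIrreducibles F, f.natDegree = n := by
  obtain ⟨p, hp⟩ := CharP.exists F
  have : Fact p.Prime := ⟨CharP.char_is_prime F p⟩
  obtain ⟨α, hα⟩ := Field.exists_primitive_element F (FiniteField.Extension F p n)
  have hint : IsIntegral F α := .of_finite F α
  refine ⟨minpoly F α, ⟨minpoly.monic hint, minpoly.irreducible hint⟩, ?_⟩
  rw [← IntermediateField.adjoin.finrank hint, hα, IntermediateField.finrank_top',
    FiniteField.finrank_extension]

/-- Finite fields have irreducibles of every positive degree. Degree 3 is missed by all three
infinite-width sets, whose members have degree 1 or even degree. -/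
theorem ne_monicIrreducibles_of_natDegree_ne {F : Type*} [Field F] [Finite F] {A : Set F[X]}
    (h : ∀ f ∈ A, f.natDegree ≠ 3) : A ≠ monicIrreducibles F := by
  obtain ⟨f, hf, h3⟩ := exists_monicIrreducibles_natDegree (F := F) 3
  rintro rfl
  exact h f hf h3

theorem infinite_of_natDegree_strictMono {F : Type*} [Field F] {A : Set F[X]} (u : ℕ → F[X])
    (hu : ∀ k, u k ∈ A) (h : StrictMono fun k => (u k).natDegree) : A.Infinite :=
  Set.infinite_of_injective_forall_mem
    (fun _ _ hab => h.injective (congrArg natDegree hab)) hu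

/-! ### Quadratics in a power of x -/

section quadPoly

variable {F : Type*} [Field F] (α β : F)

theorem quadPoly_monic : (quadPoly α β).Monic := by
  unfold quadPoly; monicity!

@[simp] theorem quadPoly_natDegree : (quadPoly α β).natDegree = 2 := by
  unfold quadPoly; compute_degree!

@[simp] theorem quadPoly_coeff_zero : (quadPoly α β).coeff 0 = β := by
  simp [quadPoly]

@[simp] theorem quadPoly_eval (x : F) : (quadPoly α β).eval x = x ^ 2 + α * x + β := by
  simp [quadPoly]

theorem quadPoly_comp_X_pow (n : ℕ) :
    (quadPoly α β).comp (X ^ n) = (X ^ n) ^ 2 + C α * X ^ n + C β := by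
  simp [quadPoly]

theorem quadPoly_comp_X_pow_sub (n : ℕ) (hn : n ≠ 0) :
    (quadPoly α β).comp (X ^ n) - C (((quadPoly α β).comp (X ^ n)).eval 0) =
      X ^ n * (X ^ n + C α) := by
  rw [eval_comp, quadPoly_comp_X_pow]
  simp [hn]; ring

theorem quadPoly_comp_X_pow_natDegree (n : ℕ) :
    ((quadPoly α β).comp (X ^ n)).natDegree = 2 * n := by
  simp [natDegree_comp]

theorem quadPoly_irreducible {α β : F} (h : ∀ x : F, x ^ 2 + α * x + β ≠ 0) :
    Irreducible (quadPoly α β) := by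
  rw [(quadPoly_monic α β).irreducible_iff_roots_eq_zero_of_degree_le_three (by simp) (by simp)]
  refine Multiset.eq_zero_of_forall_notMem fun x hx => h x ?_
  simpa using (mem_roots'.1 hx).2

theorem quadPoly_comp_mem_monicIrreducibles {n : ℕ} (hn : n ≠ 0)
    (h : Irreducible ((quadPoly α β).comp (X ^ n))) :
    (quadPoly α β).comp (X ^ n) ∈ monicIrreducibles F :=
  ⟨(quadPoly_monic α β).comp (monic_X_pow n) (by simpa using hn), h⟩

end quadPoly

/-! ### The set of width two -/

section QuadPowerSet

variable {F : Type*} [Field F] {l : ℕ} {α β : F}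

theorem X_mem_quadPowerSet : X ∈ quadPowerSet l α β := .inl (.inl rfl)

theorem X_pow_add_C_mem_quadPowerSet (k : ℕ) : X ^ l ^ k + C α ∈ quadPowerSet l α β :=
  .inl (.inr ⟨k, rfl⟩)

theorem quadPoly_comp_mem_quadPowerSet (k : ℕ) :
    (quadPoly α β).comp (X ^ l ^ k) ∈ quadPowerSet l α β :=
  .inr ⟨k, rfl⟩

theorem X_pow_add_C_sub (k : ℕ) (hl : l ≠ 0) :
    (X ^ l ^ k + C α : F[X]) - C ((X ^ l ^ k + C α : F[X]).eval 0) = X ^ l ^ k := by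
  simp [hl]

theorem quadPowerSet_isFSet (hl : l ≠ 0)
    (h1 : ∀ k, X ^ l ^ k + C α ∈ monicIrreducibles F)
    (h2 : ∀ k, (quadPoly α β).comp (X ^ l ^ k) ∈ monicIrreducibles F) :
    IsFSet (quadPowerSet l α β) := by
  refine ⟨?_, ?_⟩
  · rintro f ((rfl | ⟨k, rfl⟩) | ⟨k, rfl⟩)
    · exact X_mem_monicIrreducibles
    · exact h1 k
    · exact h2 k
  · rintro f ((rfl | ⟨k, rfl⟩) | ⟨k, rfl⟩) g hg hd
    · rw [eq_X_of_dvd_X_pow (n := 1) hg (by simpa using hd)]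
      exact X_mem_quadPowerSet
    · rw [X_pow_add_C_sub k hl] at hd
      rw [eq_X_of_dvd_X_pow hg hd]
      exact X_mem_quadPowerSet
    · rw [quadPoly_comp_X_pow_sub _ _ _ (pow_ne_zero _ hl)] at hd
      rcases hg.2.prime.dvd_or_dvd hd with hd | hd
      · rw [eq_X_of_dvd_X_pow hg hd]
        exact X_mem_quadPowerSet
      · rw [eq_of_mem_monicIrreducibles_of_dvd hg (h1 k) hd]
        exact X_pow_add_C_mem_quadPowerSet k

theorem X_pow_add_C_ne_X (hα : α ≠ 0) (k : ℕ) (hl : l ≠ 0) : (X ^ l ^ k + C α : F[X]) ≠ X := by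
  intro h
  simpa [hl, hα] using congrArg (eval 0) h

theorem quadPoly_comp_ne_X (hβ : β ≠ 0) (k : ℕ) (hl : l ≠ 0) :
    (quadPoly α β).comp (X ^ l ^ k) ≠ X := by
  intro h
  simpa [hl, hβ] using congrArg (eval 0) h

theorem quadPoly_comp_ne_X_pow_add_C (hα : α ≠ 0) (hl : l ≠ 0) (j k : ℕ) :
    (quadPoly α β).comp (X ^ l ^ k) ≠ X ^ l ^ j + C α := by
  intro h
  have hd := congrArg natDegree h
  rw [quadPoly_comp_X_pow_natDegree, natDegree_X_pow_add_C] at hd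
  -- The degrees force l^j = 2·l^k, so the coefficient at l^k is α on the left and 0 on the right.
  have hc := congrArg (fun f => coeff f (l ^ k)) h
  have hpos : 0 < l ^ k := pow_pos (Nat.pos_of_ne_zero hl) k
  rw [quadPoly_comp_X_pow, ← hd, ← pow_mul] at hc
  have e1 : l ^ k ≠ l ^ k * 2 := by omega
  have e2 : l ^ k ≠ 2 * l ^ k := by omega
  simp only [coeff_add, coeff_X_pow, coeff_C_mul, coeff_C, if_neg e1, if_neg e2,
    if_neg hpos.ne', if_true] at hc
  simp [hα] at hc

/-- The only irreducibles dividing some g - g(0) are X and the x^(l^j) + α. All of these do occur,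
and none equals an f(x^(l^k)). -/
theorem nullity_quadPowerSet (hl : l ≠ 0) (hα : α ≠ 0) (hβ : β ≠ 0)
    (h1 : ∀ k, X ^ l ^ k + C α ∈ monicIrreducibles F)
    (h2 : ∀ k, (quadPoly α β).comp (X ^ l ^ k) ∈ monicIrreducibles F) :
    nullity (quadPowerSet l α β) = {g | ∃ k : ℕ, g = (quadPoly α β).comp (X ^ l ^ k)} := by
  ext f
  constructor
  · rintro ⟨(rfl | ⟨k, rfl⟩) | ⟨k, rfl⟩, h⟩
    · exact absurd (by simp) (h X X_mem_quadPowerSet)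
    · refine absurd ?_ (h _ (quadPoly_comp_mem_quadPowerSet k))
      rw [quadPoly_comp_X_pow_sub _ _ _ (pow_ne_zero _ hl)]
      exact dvd_mul_left _ _
    · exact ⟨k, rfl⟩
  · rintro ⟨k, rfl⟩
    refine ⟨quadPoly_comp_mem_quadPowerSet k, ?_⟩
    rintro g ((rfl | ⟨j, rfl⟩) | ⟨j, rfl⟩) hd
    · exact quadPoly_comp_ne_X hβ k hl (eq_X_of_dvd_X_pow (n := 1) (h2 k) (by simpa using hd))
    · rw [X_pow_add_C_sub j hl] at hd
      exact quadPoly_comp_ne_X hβ k hl (eq_X_of_dvd_X_pow (h2 k) hd)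
    · rw [quadPoly_comp_X_pow_sub _ _ _ (pow_ne_zero _ hl)] at hd
      rcases (h2 k).2.prime.dvd_or_dvd hd with hd | hd
      · exact quadPoly_comp_ne_X hβ k hl (eq_X_of_dvd_X_pow (h2 k) hd)
      · exact quadPoly_comp_ne_X_pow_add_C hα hl j k
          (eq_of_mem_monicIrreducibles_of_dvd (h2 k) (h1 j) hd)

theorem nullity_X_union_X_pow_add_C (hl : l ≠ 0) (hα : α ≠ 0)
    (h1 : ∀ k, X ^ l ^ k + C α ∈ monicIrreducibles F) :
    nullity ({X} ∪ {g : F[X] | ∃ k : ℕ, g = X ^ l ^ k + C α}) =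
      {g | ∃ k : ℕ, g = X ^ l ^ k + C α} := by
  ext f
  constructor
  · rintro ⟨rfl | ⟨k, rfl⟩, h⟩
    · exact absurd (by simp) (h X (.inl rfl))
    · exact ⟨k, rfl⟩
  · rintro ⟨k, rfl⟩
    refine ⟨.inr ⟨k, rfl⟩, ?_⟩
    rintro g (rfl | ⟨j, rfl⟩) hd
    · exact X_pow_add_C_ne_X hα k hl (eq_X_of_dvd_X_pow (n := 1) (h1 k) (by simpa using hd))
    · rw [X_pow_add_C_sub j hl] at hd
      exact X_pow_add_C_ne_X hα k hl (eq_X_of_dvd_X_pow (h1 k) hd)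

theorem fWidth_quadPowerSet (hl : 1 < l) (hα : α ≠ 0) (hβ : β ≠ 0)
    (h1 : ∀ k, X ^ l ^ k + C α ∈ monicIrreducibles F)
    (h2 : ∀ k, (quadPoly α β).comp (X ^ l ^ k) ∈ monicIrreducibles F) :
    fWidth (quadPowerSet l α β) = 2 := by
  have hl0 : l ≠ 0 := by omega
  have hA1 : nullityFiltration (quadPowerSet l α β) 1 =
      {X} ∪ {g : F[X] | ∃ k : ℕ, g = X ^ l ^ k + C α} := by
    rw [nullityFiltration, nullityFiltration, nullity_quadPowerSet hl0 hα hβ h1 h2]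
    unfold quadPowerSet
    rw [Set.union_sdiff_right, Disjoint.sdiff_eq_left]
    rw [Set.disjoint_left]
    rintro g (rfl | ⟨j, rfl⟩) ⟨k, hk⟩
    · exact quadPoly_comp_ne_X hβ k hl0 hk.symm
    · exact quadPoly_comp_ne_X_pow_add_C hα hl0 j k hk.symm
  have hinf : ({X} ∪ {g : F[X] | ∃ k : ℕ, g = X ^ l ^ k + C α}).Infinite := by
    refine infinite_of_natDegree_strictMono (fun k => X ^ l ^ k + C α) (fun k => .inr ⟨k, rfl⟩) ?_
    simpa only [natDegree_X_pow_add_C] using pow_right_strictMono₀ hl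
  have hA2 : nullityFiltration (quadPowerSet l α β) 2 = {X} := by
    rw [nullityFiltration, hA1, nullity_X_union_X_pow_add_C hl0 hα h1,
      Set.union_sdiff_right, Disjoint.sdiff_eq_left]
    rw [Set.disjoint_left]
    rintro g rfl ⟨k, hk⟩
    exact X_pow_add_C_ne_X hα k hl0 hk.symm
  apply le_antisymm
  · exact iInf₂_le 2 (by rw [hA2]; exact Set.finite_singleton _)
  · refine le_iInf₂ fun n hn => ?_
    have : 2 ≤ n := by
      by_contra hlt
      have : n = 0 ∨ n = 1 := by omega
      rcases this with rfl | rfl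
      · exact hinf (hn.subset Set.subset_union_left)
      · rw [hA1] at hn
        exact hinf hn
    exact_mod_cast this

theorem quadPowerSet_ne_monicIrreducibles (hl : l ≠ 0) (h1 : α ≠ 1) :
    quadPowerSet l α β ≠ monicIrreducibles F := by
  intro h
  -- The only linear members are X and X + α, so X + 1 is missing.
  have hm : X + C 1 ∈ monicIrreducibles F := by
    refine ⟨monic_X_add_C 1, ?_⟩
    simpa using irreducible_X_sub_C (-1 : F)
  rw [← h] at hm
  rcases hm with (hm | ⟨k, hm⟩) | ⟨k, hm⟩
  · simp at hm
  · have := congrArg (eval 0) hm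
    simp [hl] at this
    exact h1 this.symm
  · have := congrArg natDegree hm
    rw [quadPoly_comp_X_pow_natDegree, natDegree_X_add_C] at this
    omega

end QuadPowerSet

/-- The scalars for which `quadPowerSet` has width two. -/
theorem quadPowerSet_width_two {F : Type*} [Field F] [Finite F] {l : ℕ} {α β : F} (hl : l.Prime)
    (hi : l ≠ 2 ∨ IsSquare (-1 : F))
    (hα : ¬ ∃ γ : F, γ ^ l = α) (hβ : ¬ ∃ γ : F, γ ^ l = β) (hf : Irreducible (quadPoly α β)) :
    IsFSet (quadPowerSet l α β) ∧ quadPowerSet l α β ≠ monicIrreducibles F ∧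
      fWidth (quadPowerSet l α β) = 2 := by
  have hα0 : α ≠ 0 := fun h => hα ⟨0, by simp [h, hl.ne_zero]⟩
  have hβ0 : β ≠ 0 := fun h => hβ ⟨0, by simp [h, hl.ne_zero]⟩
  have h1 : ∀ k, X ^ l ^ k + C α ∈ monicIrreducibles F := fun k => by
    refine ⟨monic_X_pow_add_C _ (pow_ne_zero _ hl.ne_zero), ?_⟩
    -- Since -1 is an l-th power, -α is as far from being one as α.
    have hneg : ∀ b : F, b ^ l ≠ -α := fun b hb => by
      rcases hi with hi | ⟨i, hi⟩
      · exact hα ⟨-b, by rw [(hl.odd_of_ne_two hi).neg_pow, hb, neg_neg]⟩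
      · rcases hl.eq_two_or_odd' with rfl | ho
        · exact hα ⟨i * b, by rw [mul_pow, hb, sq, ← hi]; ring⟩
        · exact hα ⟨-b, by rw [ho.neg_pow, hb, neg_neg]⟩
    simpa using X_pow_prime_pow_sub_C_irreducible hl hi hneg k
  have h2 : ∀ k, (quadPoly α β).comp (X ^ l ^ k) ∈ monicIrreducibles F := fun k => by
    refine quadPoly_comp_mem_monicIrreducibles _ _ (pow_ne_zero _ hl.ne_zero) ?_
    refine irreducible_comp_of_coeff_zero hl (quadPoly_monic α β) hf ?_ ?_ k
    · simp
    · simpa using hβ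
  exact ⟨quadPowerSet_isFSet hl.ne_zero h1 h2,
    quadPowerSet_ne_monicIrreducibles hl.ne_zero fun h => hα ⟨1, by simp [h]⟩,
    fWidth_quadPowerSet hl.one_lt hα0 hβ0 h1 h2⟩

/-! ### Choice of l, α and β -/

theorem isSquare_mul_of_not_isSquare {F : Type*} [Field F] [Finite F] {a b : F}
    (ha : ¬ IsSquare a) (hb : ¬ IsSquare b) : IsSquare (a * b) := by
  classical
  have := Fintype.ofFinite F
  have hF : ringChar F ≠ 2 := fun h => ha (FiniteField.isSquare_of_char_two h a)
  have ha' := (quadraticChar_neg_one_iff_not_isSquare (a := a)).2 ha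
  have hb' := (quadraticChar_neg_one_iff_not_isSquare (a := b)).2 hb
  have h0 : a * b ≠ 0 := by
    rintro h
    rcases mul_eq_zero.1 h with rfl | rfl
    · exact ha (.zero)
    · exact hb (.zero)
  rw [← quadraticChar_one_iff_isSquare h0, map_mul, ha', hb']; norm_num

theorem exists_quadPoly_of_card_mod_four {F : Type*} [Field F] [Finite F]
    (h : Nat.card F % 4 = 1) :
    ∃ α β : F, IsSquare (-1 : F) ∧ (¬ ∃ γ : F, γ ^ 2 = α) ∧ (¬ ∃ γ : F, γ ^ 2 = β) ∧
      Irreducible (quadPoly α β) := by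
  have := Fintype.ofFinite F
  rw [Nat.card_eq_fintype_card] at h
  have hsq : IsSquare (-1 : F) := FiniteField.isSquare_neg_one_iff.2 (by omega)
  have hchar : ringChar F ≠ 2 := fun hc => by
    have := FiniteField.even_card_of_char_two hc
    omega
  have h2 : (2 : F) ≠ 0 := Ring.two_ne_zero hchar
  obtain ⟨α, hα⟩ := FiniteField.exists_nonsquare hchar
  have hα0 : α ≠ 0 := by rintro rfl; exact hα .zero
  -- If 1 + α is a square, then 1 + α⁻¹ = (1 + α)/α is not, so α⁻¹ serves instead of α.
  obtain ⟨s, hs, hs1⟩ : ∃ s : F, ¬ IsSquare s ∧ ¬ IsSquare (1 + s) := by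
    by_cases h1 : IsSquare (1 + α)
    · refine ⟨α⁻¹, by simpa using hα, fun h => hα ?_⟩
      have hne : 1 + α ≠ 0 := fun h0 => hα (by rwa [← neg_eq_of_add_eq_zero_right h0])
      have : α = (1 + α) / (1 + α⁻¹) := by
        have : 1 + α⁻¹ ≠ 0 := fun h0 => hne (by
          have := congrArg (· * α) h0
          simpa [add_mul, hα0, add_comm] using this)
        exact eq_div_of_mul_eq this (by rw [mul_add, mul_inv_cancel₀ hα0]; ring)
      rw [this]
      exact h1.div h
    · exact ⟨α, hα, h1⟩
  obtain ⟨i, hi⟩ := hsq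
  have hi0 : i ≠ 0 := by rintro rfl; simp at hi
  -- As i² = -1, this β makes the discriminant α² - 4β equal to α²(1 + s), a nonsquare, and β is a
  -- nonsquare along with s.
  refine ⟨α, s * (i * α / 2) ^ 2, ⟨i, hi⟩, ?_, ?_, ?_⟩
  · rintro ⟨γ, hγ⟩; exact hα ⟨γ, by rw [← hγ, sq]⟩
  · rintro ⟨γ, hγ⟩
    refine hs ⟨γ / (i * α / 2), ?_⟩
    rw [← sq, div_pow, hγ]; field_simp
  · refine quadPoly_irreducible fun x hx => hs1 ⟨(2 * x + α) / α, ?_⟩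
    have h4 : (2 * x + α) ^ 2 = α ^ 2 * (1 + s) := by
      have e : s * (i * α / 2) ^ 2 * 4 = - (s * α ^ 2) := by
        rw [div_pow, mul_pow, sq i, ← hi]
        field_simp; ring
      linear_combination 4 * hx - e
    rw [← sq, div_pow, h4]; field_simp

/-- Scaling a rootless x² + x + t gives the irreducible x² + ax + ta² for each a ≠ 0. Take g not an
l-th power and try a = g, then a = g⁻¹. If both tg² and tg⁻² were l-th powers, so would be their
quotient g⁴, and hence g, because l is prime to 4. -/
theorem exists_quadPoly_of_odd_prime_dvd {F : Type*} [Field F] [Finite F] {l : ℕ}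
    (hl : l.Prime) (hl2 : l ≠ 2) (hd : l ∣ Nat.card F - 1) :
    ∃ α β : F, (¬ ∃ γ : F, γ ^ l = α) ∧ (¬ ∃ γ : F, γ ^ l = β) ∧ Irreducible (quadPoly α β) := by
  obtain ⟨t, ht⟩ : ∃ t : F, ∀ x : F, x ^ 2 + x + t ≠ 0 := by
    -- The values at 0 and -1 coincide, so on a finite field this map misses some t.
    have hni : ¬ Function.Injective fun x : F => -(x ^ 2 + x) := fun h =>
      neg_ne_zero.2 one_ne_zero (h (show -((-1 : F) ^ 2 + -1) = -(0 ^ 2 + 0) by ring))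
    rw [Finite.injective_iff_surjective] at hni
    simp only [Function.Surjective, not_forall, not_exists] at hni
    obtain ⟨t, ht⟩ := hni
    exact ⟨t, fun x hx => ht x (by linear_combination -hx)⟩
  have ht0 : t ≠ 0 := by rintro rfl; exact ht 0 (by ring)
  obtain ⟨g, hg⟩ : ∃ g : F, ¬ ∃ γ : F, γ ^ l = g := by
    have : Fact l.Prime := ⟨hl⟩
    have hns : ¬ Function.Surjective fun x : F => x ^ l := by
      rw [← Finite.injective_iff_surjective]
      intro h
      obtain ⟨u, hu⟩ := exists_prime_orderOf_dvd_card' (G := Fˣ) l (by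
        rwa [Nat.card_units])
      have hu1 : u = 1 := by
        have : (u : F) ^ l = 1 ^ l := by
          rw [one_pow, ← Units.val_pow_eq_pow_val, ← hu, pow_orderOf_eq_one, Units.val_one]
        exact Units.ext (h this)
      rw [hu1, orderOf_one] at hu
      exact hl.one_lt.ne hu
    simpa [Function.Surjective] using hns
  have hg0 : g ≠ 0 := by rintro rfl; exact hg ⟨0, by simp [hl.ne_zero]⟩
  have main : ∀ a : F, a ≠ 0 → Irreducible (quadPoly a (t * a ^ 2)) := fun a ha => by
    refine quadPoly_irreducible fun x hx => ht (x / a) ?_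
    have : (x / a) ^ 2 + x / a + t = (x ^ 2 + a * x + t * a ^ 2) / a ^ 2 := by
      field_simp
    rw [this, hx, zero_div]
  by_cases h1 : ∃ γ : F, γ ^ l = t * g ^ 2
  · refine ⟨g⁻¹, t * g⁻¹ ^ 2, ?_, ?_, main _ (inv_ne_zero hg0)⟩
    · rintro ⟨γ, hγ⟩; exact hg ⟨γ⁻¹, by rw [inv_pow, hγ, inv_inv]⟩
    · rintro ⟨δ, hδ⟩
      obtain ⟨γ, hγ⟩ := h1
      have h4 : (γ / δ) ^ l = g ^ 4 := by
        rw [div_pow, hγ, hδ]; field_simp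
      obtain ⟨m, hm⟩ : ∃ m : ℤ, ∃ n : ℤ, 4 * m + l * n = 1 := by
        have : Nat.Coprime 4 l := by
          rw [show 4 = 2 ^ 2 by norm_num]
          exact Nat.Coprime.pow_left 2 ((Nat.coprime_primes Nat.prime_two hl).2 (Ne.symm hl2))
        exact ⟨Nat.gcdA 4 l, Nat.gcdB 4 l, by
          have h := Nat.gcd_eq_gcd_ab 4 l
          rw [Nat.Coprime.gcd_eq_one this] at h
          exact_mod_cast h.symm⟩
      obtain ⟨n, hmn⟩ := hm
      refine hg ⟨(γ / δ) ^ m * g ^ n, ?_⟩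
      calc ((γ / δ) ^ m * g ^ n) ^ l = ((γ / δ) ^ l) ^ m * g ^ ((l : ℤ) * n) := by
            rw [mul_pow, ← zpow_natCast, ← zpow_natCast, ← zpow_natCast, ← zpow_mul, ← zpow_mul,
              ← zpow_mul, mul_comm m, mul_comm n]
        _ = g ^ ((4 : ℤ) * m + l * n) := by
            rw [h4, zpow_add₀ hg0, zpow_mul g 4]; norm_cast
        _ = g := by rw [hmn, zpow_one]
  · exact ⟨g, t * g ^ 2, hg, h1, main g hg0⟩

theorem exists_quadPowerSet_width_two {F : Type*} [Field F] [Finite F]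
    (h2 : Nat.card F ≠ 2) (h3 : Nat.card F ≠ 3) :
    ∃ (l : ℕ) (α β : F), l.Prime ∧ l ∣ Nat.card F - 1 ∧
      (¬ ∃ γ : F, γ ^ l = α) ∧ (¬ ∃ γ : F, γ ^ l = β) ∧ Irreducible (quadPoly α β) ∧
      IsFSet (quadPowerSet l α β) ∧ quadPowerSet l α β ≠ monicIrreducibles F ∧
      fWidth (quadPowerSet l α β) = 2 := by
  by_cases h4 : Nat.card F % 4 = 1
  · obtain ⟨α, β, hi, hα, hβ, hf⟩ := exists_quadPoly_of_card_mod_four h4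
    exact ⟨2, α, β, Nat.prime_two, by omega, hα, hβ, hf,
      quadPowerSet_width_two Nat.prime_two (.inr hi) hα hβ hf⟩
  -- For q even, q - 1 is odd and exceeds 1; for q ≡ 3 mod 4, the same holds of (q - 1)/2 since q ≠
  -- 3.
  · obtain ⟨l, hl, hl2, hd⟩ : ∃ l : ℕ, l.Prime ∧ l ≠ 2 ∧ l ∣ Nat.card F - 1 := by
      have h1 : 1 < Nat.card F := Finite.one_lt_card
      rcases Nat.even_or_odd (Nat.card F) with he | ho
      · obtain ⟨l, hl, hd⟩ := Nat.exists_prime_and_dvd (n := Nat.card F - 1) (by omega)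
        refine ⟨l, hl, ?_, hd⟩
        rintro rfl
        rw [Nat.even_iff] at he
        omega
      · rw [Nat.odd_iff] at ho
        obtain ⟨l, hl, hd⟩ := Nat.exists_prime_and_dvd (n := (Nat.card F - 1) / 2) (by omega)
        refine ⟨l, hl, ?_, hd.trans ⟨2, by omega⟩⟩
        rintro rfl
        omega
    obtain ⟨α, β, hα, hβ, hf⟩ := exists_quadPoly_of_odd_prime_dvd hl hl2 hd
    exact ⟨l, α, β, hl, hd, hα, hβ, hf, quadPowerSet_width_two hl (.inl hl2) hα hβ hf⟩

/-! ### Infinite width for q ≡ 2, 5 mod 9 -/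

section SignedCyclotomic

/-- The set `{x} ∪ {x + ε} ∪ {h(x^(3^k)) : k ≥ 0}`, where `ε` runs through the square roots of `1`
and `h = x² + εx + 1` is the third or the sixth cyclotomic polynomial. -/
def cyclotomicThreePowerSet (F : Type*) [Field F] : Set F[X] :=
  {X} ∪ {g | ∃ ε : F, ε ^ 2 = 1 ∧ g = X + C ε} ∪
    {g | ∃ (ε : F) (k : ℕ), ε ^ 2 = 1 ∧ g = (quadPoly ε 1).comp (X ^ 3 ^ k)}

/-- A root x is a primitive third or sixth root of unity; squaring removes the sign, so x² has order
exactly 3 in either case. -/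
theorem orderOf_eq_of_quadratic {K : Type*} [Field K] (h3 : (3 : K) ≠ 0) {ε x : K}
    (hε : ε ^ 2 = 1) (hx : x ^ 2 + ε * x + 1 = 0) : (x ^ 2) ^ 3 = 1 ∧ x ^ 2 ≠ 1 := by
  have h6 : (x ^ 2) ^ 3 = 1 := by
    linear_combination (x ^ 4 - ε * x ^ 3 + ε * x - 1) * hx + (x ^ 4 - x ^ 2) * hε
  refine ⟨h6, fun h1 => h3 ?_⟩
  have h2 : ε * x = -2 := by linear_combination hx - h1
  have h4 : (ε * x) ^ 2 = 1 := by rw [mul_pow, hε, h1, one_mul]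
  rw [h2] at h4
  linear_combination h4

theorem three_pow_dvd_natCard_sub_one {K : Type*} [Field K] [Finite K] {y : K} {n : ℕ}
    (h : y ^ 3 ^ (n + 1) = 1) (h1 : y ^ 3 ^ n ≠ 1) : 3 ^ (n + 1) ∣ Nat.card K - 1 := by
  have hy : y ≠ 0 := by rintro rfl; simp at h
  obtain ⟨u, rfl⟩ : IsUnit y := hy.isUnit
  have ho : orderOf u = 3 ^ (n + 1) := by
    have : Fact (Nat.Prime 3) := ⟨Nat.prime_three⟩
    exact orderOf_eq_prime_pow (fun e => h1 (by simpa using congrArg Units.val e))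
      (Units.ext (by simpa using h))
  rw [← ho, ← Nat.card_units]
  exact orderOf_dvd_natCard u

variable {F : Type u} [Field F]

/-- Write h_ε = x² + εx + 1. Then h_ε(x^(3^k)) divides x^(3^(k+1)) - ε, which divides
h_{-ε}(x^(3^(k+1))) - 1: the sign alternates along the chain. -/
theorem nullity_cyclotomicThreePowerSet : nullity (cyclotomicThreePowerSet F) = ∅ := by
  refine Set.eq_empty_iff_forall_notMem.2 ?_
  rintro f ⟨(rfl | ⟨ε, hε, rfl⟩) | ⟨ε, k, hε, rfl⟩, h⟩
  · exact h X (.inl (.inl rfl)) (by simp)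
  · refine h _ (.inr ⟨ε, 0, hε, rfl⟩) ?_
    rw [quadPoly_comp_X_pow_sub _ _ _ (by positivity)]
    exact ⟨X, by simp [mul_comm]⟩
  · refine h _ (.inr ⟨-ε, k + 1, by rw [neg_sq, hε], rfl⟩) ?_
    rw [quadPoly_comp_X_pow_sub _ _ _ (by positivity)]
    refine Dvd.dvd.mul_left ⟨X ^ 3 ^ k - C ε, ?_⟩ _
    have hC : (C ε : F[X]) ^ 2 = 1 := by rw [← map_pow, hε, map_one]
    rw [quadPoly_comp_X_pow, pow_succ, pow_mul]
    simp only [map_neg, map_one]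
    linear_combination (X ^ 3 ^ k) * hC

variable [Finite F]

theorem three_ne_zero_of_card (hq : Nat.card F % 3 = 2) : (3 : F) ≠ 0 := by
  intro h
  have : Fact (Nat.Prime 3) := ⟨Nat.prime_three⟩
  have hc : CharP F 3 := (CharP.charP_iff_prime_eq_zero Nat.prime_three).2 (by exact_mod_cast h)
  have := Fintype.ofFinite F
  obtain ⟨n, -, hn⟩ := FiniteField.card F 3
  rw [Nat.card_eq_fintype_card, hn] at hq
  have := dvd_pow_self 3 n.ne_zero
  omega

theorem quadPoly_one_irreducible (h3 : (3 : F) ≠ 0) (hq : Nat.card F % 3 = 2) {ε : F}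
    (hε : ε ^ 2 = 1) : Irreducible (quadPoly ε 1) := by
  refine quadPoly_irreducible fun x hx => ?_
  obtain ⟨h6, h2⟩ := orderOf_eq_of_quadratic h3 hε hx
  have := three_pow_dvd_natCard_sub_one (n := 0) (by simpa using h6) (by simpa using h2)
  omega

/-- If a root were a cube b³ in the field of q² elements, b² would have order 9 and 9 would divide
q² - 1. But q² ≡ 4 or 7 mod 9. -/
theorem quadPoly_one_comp_irreducible (h3 : (3 : F) ≠ 0)
    (hq : Nat.card F % 9 = 2 ∨ Nat.card F % 9 = 5) {ε : F} (hε : ε ^ 2 = 1) (k : ℕ) :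
    Irreducible ((quadPoly ε 1).comp (X ^ 3 ^ k)) := by
  have hirr := quadPoly_one_irreducible h3 (by omega) hε
  refine irreducible_comp_X_pow_prime_pow Nat.prime_three (quadPoly_monic ε 1) hirr
    (fun E _ _ x hx => ⟨.inl (by norm_num), fun b hb => ?_⟩) k
  obtain ⟨hfin, hcard⟩ :=
    finite_field_natCard_adjoin (isIntegral_of_minpoly_eq hirr.ne_zero hx)
  have h3' : (3 : IntermediateField.adjoin F {x}) ≠ 0 := by
    have := (map_ne_zero (algebraMap F (IntermediateField.adjoin F {x}))).2 h3
    rwa [map_ofNat] at this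
  have hroot : (b ^ 3) ^ 2 + algebraMap F (IntermediateField.adjoin F {x}) ε * b ^ 3 + 1 = 0 := by
    have h := minpoly.aeval F (IntermediateField.AdjoinSimple.gen F x)
    rw [IntermediateField.minpoly_gen, hx] at h
    rw [hb]
    simpa [quadPoly] using h
  obtain ⟨h6, h2⟩ := orderOf_eq_of_quadratic h3' (by rw [← map_pow, hε, map_one]) hroot
  have h9 := three_pow_dvd_natCard_sub_one (y := b ^ 2) (n := 1)
    (by rw [← h6]; ring) (by rw [pow_one, ← pow_mul, mul_comm, pow_mul]; exact h2)
  rw [hcard, hx, quadPoly_natDegree] at h9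
  have h1 : Nat.card F ^ 2 % 9 = 4 ∨ Nat.card F ^ 2 % 9 = 7 := by
    rw [Nat.pow_mod]
    rcases hq with h | h <;> simp [h]
  omega

theorem mem_cyclotomicThreePowerSet_of_dvd (h3 : (3 : F) ≠ 0)
    (hq : Nat.card F % 9 = 2 ∨ Nat.card F % 9 = 5) {ε : F} (hε : ε ^ 2 = 1) {g : F[X]}
    (hg : g ∈ monicIrreducibles F) {k : ℕ} (hd : g ∣ X ^ 3 ^ k + C ε) :
    g ∈ cyclotomicThreePowerSet F := by
  induction k with
  | zero =>
    refine .inl (.inr ⟨ε, hε, eq_of_mem_monicIrreducibles_of_dvd hg ⟨monic_X_add_C ε, ?_⟩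
      (by simpa using hd)⟩)
    simpa using irreducible_X_sub_C (-ε)
  | succ k ih =>
    have hneg : (-ε) ^ 2 = 1 := by rw [neg_sq, hε]
    have hfac : (X ^ 3 ^ (k + 1) + C ε : F[X]) =
        (X ^ 3 ^ k + C ε) * (quadPoly (-ε) 1).comp (X ^ 3 ^ k) := by
      have hC : (C ε : F[X]) ^ 2 = 1 := by rw [← map_pow, hε, map_one]
      rw [quadPoly_comp_X_pow, pow_succ, pow_mul]
      simp only [map_neg, map_one]
      linear_combination (X ^ 3 ^ k) * hC
    rw [hfac] at hd
    rcases hg.2.prime.dvd_or_dvd hd with hd | hd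
    · exact ih hd
    · exact .inr ⟨-ε, k, hneg, eq_of_mem_monicIrreducibles_of_dvd hg
        (quadPoly_comp_mem_monicIrreducibles _ _ (by positivity)
          (quadPoly_one_comp_irreducible h3 hq hneg k)) hd⟩

theorem cyclotomicThreePowerSet_isFSet (h3 : (3 : F) ≠ 0)
    (hq : Nat.card F % 9 = 2 ∨ Nat.card F % 9 = 5) : IsFSet (cyclotomicThreePowerSet F) := by
  refine ⟨?_, ?_⟩
  · rintro f ((rfl | ⟨ε, -, rfl⟩) | ⟨ε, k, hε, rfl⟩)
    · exact X_mem_monicIrreducibles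
    · exact ⟨monic_X_add_C ε, by simpa using irreducible_X_sub_C (-ε)⟩
    · exact quadPoly_comp_mem_monicIrreducibles _ _ (by positivity)
        (quadPoly_one_comp_irreducible h3 hq hε k)
  · rintro f ((rfl | ⟨ε, -, rfl⟩) | ⟨ε, k, hε, rfl⟩) g hg hd
    · rw [eq_X_of_dvd_X_pow (n := 1) hg (by simpa using hd)]
      exact .inl (.inl rfl)
    · rw [eq_X_of_dvd_X_pow (n := 1) hg (by simpa using hd)]
      exact .inl (.inl rfl)
    · rw [quadPoly_comp_X_pow_sub _ _ _ (by positivity)] at hd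
      rcases hg.2.prime.dvd_or_dvd hd with hd | hd
      · rw [eq_X_of_dvd_X_pow hg hd]
        exact .inl (.inl rfl)
      · exact mem_cyclotomicThreePowerSet_of_dvd h3 hq hε hg hd

theorem cyclotomicThreePowerSet_infinite_width
    (hq : Nat.card F % 9 = 2 ∨ Nat.card F % 9 = 5) :
    IsFSet (cyclotomicThreePowerSet F) ∧ cyclotomicThreePowerSet F ≠ monicIrreducibles F ∧
      fWidth (cyclotomicThreePowerSet F) = ⊤ := by
  refine ⟨cyclotomicThreePowerSet_isFSet (three_ne_zero_of_card (by omega)) hq,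
    ne_monicIrreducibles_of_natDegree_ne ?_,
    fWidth_eq_top ?_ nullity_cyclotomicThreePowerSet⟩
  · rintro f ((rfl | ⟨ε, -, rfl⟩) | ⟨ε, k, -, rfl⟩)
    · simp
    · simp
    · rw [quadPoly_comp_X_pow_natDegree]; omega
  · refine infinite_of_natDegree_strictMono (fun k => (quadPoly 1 1).comp (X ^ 3 ^ k))
      (fun k => .inr ⟨1, k, one_pow 2, rfl⟩) ?_
    simp only [quadPoly_comp_X_pow_natDegree]
    exact (pow_right_strictMono₀ (by norm_num)).const_mul (by norm_num)

end SignedCyclotomic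

/-! ### Infinite width for q ≡ 5 mod 8: iterates of x² - 2 -/

section Dickson

/-- The `n`-th iterate of `x² - 2`. -/
noncomputable def sqSubTwoIterate (F : Type*) [Field F] : ℕ → F[X]
  | 0 => X
  | n + 1 => (sqSubTwoIterate F n).comp (X ^ 2 - C 2)

variable {F : Type*} [Field F]

/-- The recursion of the definition substitutes on the inside, which suits irreducibility; this
outer form gives the factorisations. -/
theorem sqSubTwoIterate_succ (n : ℕ) :
    sqSubTwoIterate F (n + 1) = sqSubTwoIterate F n ^ 2 - C 2 := by
  induction n with
  | zero => simp [sqSubTwoIterate]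
  | succ n ih =>
    change (sqSubTwoIterate F (n + 1)).comp (X ^ 2 - C 2) =
      ((sqSubTwoIterate F n).comp (X ^ 2 - C 2)) ^ 2 - C 2
    rw [ih, sub_comp, pow_comp, C_comp]

theorem sqSubTwoIterate_monic (n : ℕ) : (sqSubTwoIterate F n).Monic := by
  induction n with
  | zero => exact monic_X
  | succ n ih =>
    exact ih.comp (monic_X_pow_sub_C 2 two_ne_zero) (by rw [natDegree_X_pow_sub_C]; norm_num)

theorem sqSubTwoIterate_natDegree (n : ℕ) : (sqSubTwoIterate F n).natDegree = 2 ^ n := by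
  induction n with
  | zero => simp [sqSubTwoIterate]
  | succ n ih => rw [sqSubTwoIterate, natDegree_comp, ih, natDegree_X_pow_sub_C, pow_succ]

theorem sqSubTwoIterate_eval_two (n : ℕ) : (sqSubTwoIterate F n).eval 2 = 2 := by
  induction n with
  | zero => simp [sqSubTwoIterate]
  | succ n ih => rw [sqSubTwoIterate_succ]; simp [ih]; norm_num

theorem sqSubTwoIterate_eval_neg_two (n : ℕ) : (sqSubTwoIterate F (n + 1)).eval (-2) = 2 := by
  rw [sqSubTwoIterate, eval_comp, ← sqSubTwoIterate_eval_two (F := F) n]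
  congr 1; simp [sqSubTwoIterate_eval_two]; norm_num

/-- The orbit of 0 under x² - 2 is 0, -2, 2, 2, …, so the constant term is 2 from the second iterate
on. -/
theorem sqSubTwoIterate_eval_zero (n : ℕ) : (sqSubTwoIterate F (n + 2)).eval 0 = 2 := by
  rw [sqSubTwoIterate, eval_comp, ← sqSubTwoIterate_eval_neg_two (F := F) n]
  congr 1; simp [sqSubTwoIterate_eval_neg_two]

/-- Pₙ₊₂ - 2 = Pₙ₊₁² - 4 = (Pₙ₊₁ - 2)(Pₙ₊₁ + 2), and Pₙ₊₁ + 2 = Pₙ². -/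
theorem sqSubTwoIterate_sub_two (n : ℕ) :
    sqSubTwoIterate F (n + 2) - C 2 =
      (sqSubTwoIterate F (n + 1) - C 2) * sqSubTwoIterate F n ^ 2 := by
  have h : (C 2 : F[X]) = 2 := map_ofNat C 2
  rw [sqSubTwoIterate_succ (n + 1), sqSubTwoIterate_succ n, h]
  ring

/-- The set `{x, x - 2, x + 2}` together with the iterates of `x² - 2`. -/
def sqSubTwoSet (F : Type*) [Field F] : Set F[X] :=
  {X - C 2, X + C 2} ∪ Set.range (sqSubTwoIterate F)

theorem sqSubTwoIterate_one_sub_two :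
    sqSubTwoIterate F 1 - C 2 = (X - C 2) * (X + C 2) := by
  have h : (C 2 : F[X]) = 2 := map_ofNat C 2
  simp only [sqSubTwoIterate, X_comp, h]
  ring

theorem X_sub_C_mem_monicIrreducibles (a : F) : X - C a ∈ monicIrreducibles F :=
  ⟨monic_X_sub_C a, irreducible_X_sub_C a⟩

theorem X_add_C_mem_monicIrreducibles (a : F) : X + C a ∈ monicIrreducibles F :=
  ⟨monic_X_add_C a, by simpa using irreducible_X_sub_C (-a)⟩

theorem X_mem_sqSubTwoSet : X ∈ sqSubTwoSet F := .inr ⟨0, rfl⟩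

theorem nullity_sqSubTwoSet : nullity (sqSubTwoSet F) = ∅ := by
  have hmain : ∀ n, sqSubTwoIterate F (n + 2) -
      C ((sqSubTwoIterate F (n + 2)).eval 0) =
      (sqSubTwoIterate F (n + 1) - C 2) * sqSubTwoIterate F n ^ 2 := fun n => by
    rw [sqSubTwoIterate_eval_zero, sqSubTwoIterate_sub_two]
  refine Set.eq_empty_iff_forall_notMem.2 ?_
  rintro f ⟨(rfl | rfl) | ⟨n, rfl⟩, h⟩
  · refine h _ (.inr ⟨0 + 2, rfl⟩) ?_
    rw [hmain, zero_add, sqSubTwoIterate_one_sub_two]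
    exact (dvd_mul_right _ _).mul_right _
  · refine h _ (.inr ⟨0 + 2, rfl⟩) ?_
    rw [hmain, zero_add, sqSubTwoIterate_one_sub_two]
    exact (dvd_mul_left _ _).mul_right _
  · refine h _ (.inr ⟨n + 2, rfl⟩) ?_
    rw [hmain]
    exact (dvd_pow_self _ two_ne_zero).mul_left _

variable [Finite F]

/-- Pₙ₊₁ is Pₙ(x - 2) evaluated at x². The root norm of Pₙ(x - 2) is (-1)^(2^n) Pₙ(-2), which is 2
for every n (the signs cancel when n = 0), a nonsquare. -/
theorem sqSubTwoIterate_irreducible (h2 : ¬ IsSquare (2 : F)) (hi : IsSquare (-1 : F)) (n : ℕ) :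
    Irreducible (sqSubTwoIterate F n) := by
  have hneg : ¬ IsSquare (-2 : F) := fun h => h2 (by simpa using hi.mul h)
  induction n with
  | zero => exact irreducible_X
  | succ n ih =>
    have hshift : sqSubTwoIterate F (n + 1) =
        ((sqSubTwoIterate F n).comp (X - C 2)).comp (X ^ 2 ^ 1) := by
      rw [sqSubTwoIterate, comp_assoc]; simp
    have hirr : Irreducible ((sqSubTwoIterate F n).comp (X - C 2)) := by
      have := (MulEquiv.irreducible_iff (algEquivAevalXAddC (-2 : F))).2 ih
      simpa [algEquivAevalXAddC, aeval_def, comp, sub_eq_add_neg] using this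
    rw [hshift]
    refine irreducible_comp_of_coeff_zero Nat.prime_two
      ((sqSubTwoIterate_monic n).comp (monic_X_sub_C 2) (by simp)) hirr (.inr (.inl hi)) ?_ 1
    intro b hb
    rw [coeff_zero_eq_eval_zero, eval_comp, natDegree_comp, sqSubTwoIterate_natDegree,
      natDegree_X_sub_C, mul_one] at hb
    simp only [eval_sub, eval_X, eval_C, zero_sub] at hb
    rcases n with _ | n
    · exact h2 ⟨b, by rw [← sq, hb]; simp [sqSubTwoIterate]⟩
    · rw [sqSubTwoIterate_eval_neg_two] at hb
      exact h2 ⟨b, by rw [← sq, hb, Even.neg_one_pow (by simp [Nat.even_pow])]; simp⟩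

theorem sqSubTwoIterate_mem_monicIrreducibles (h2 : ¬ IsSquare (2 : F))
    (hi : IsSquare (-1 : F)) (n : ℕ) : sqSubTwoIterate F n ∈ monicIrreducibles F :=
  ⟨sqSubTwoIterate_monic n, sqSubTwoIterate_irreducible h2 hi n⟩

theorem mem_sqSubTwoSet_of_dvd (h2 : ¬ IsSquare (2 : F)) (hi : IsSquare (-1 : F)) {g : F[X]}
    (hg : g ∈ monicIrreducibles F) (n : ℕ) (hd : g ∣ sqSubTwoIterate F (n + 1) - C 2) :
    g ∈ sqSubTwoSet F := by
  induction n with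
  | zero =>
    rw [zero_add, sqSubTwoIterate_one_sub_two] at hd
    rcases hg.2.prime.dvd_or_dvd hd with hd | hd
    · exact .inl (.inl (eq_of_mem_monicIrreducibles_of_dvd hg
        (X_sub_C_mem_monicIrreducibles 2) hd))
    · exact .inl (.inr (eq_of_mem_monicIrreducibles_of_dvd hg
        (X_add_C_mem_monicIrreducibles 2) hd))
  | succ n ih =>
    rw [sqSubTwoIterate_sub_two] at hd
    rcases hg.2.prime.dvd_or_dvd hd with hd | hd
    · exact ih hd
    · exact .inr ⟨n, (eq_of_mem_monicIrreducibles_of_dvd hg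
        (sqSubTwoIterate_mem_monicIrreducibles h2 hi n) (hg.2.prime.dvd_of_dvd_pow hd)).symm⟩

theorem sqSubTwoSet_isFSet (h2 : ¬ IsSquare (2 : F)) (hi : IsSquare (-1 : F)) :
    IsFSet (sqSubTwoSet F) := by
  refine ⟨?_, ?_⟩
  · rintro f ((rfl | rfl) | ⟨n, rfl⟩)
    · exact X_sub_C_mem_monicIrreducibles 2
    · exact X_add_C_mem_monicIrreducibles 2
    · exact sqSubTwoIterate_mem_monicIrreducibles h2 hi n
  · rintro f ((rfl | rfl) | ⟨_ | _ | n, rfl⟩) g hg hd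
    · rw [eq_X_of_dvd_X_pow (n := 1) hg (by simpa using hd)]
      exact X_mem_sqSubTwoSet
    · rw [eq_X_of_dvd_X_pow (n := 1) hg (by simpa using hd)]
      exact X_mem_sqSubTwoSet
    · rw [eq_X_of_dvd_X_pow (n := 1) hg (by simpa [sqSubTwoIterate] using hd)]
      exact X_mem_sqSubTwoSet
    · rw [eq_X_of_dvd_X_pow (n := 2) hg (by simpa [sqSubTwoIterate] using hd)]
      exact X_mem_sqSubTwoSet
    · rw [sqSubTwoIterate_eval_zero] at hd
      exact mem_sqSubTwoSet_of_dvd h2 hi hg (n + 1) hd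

theorem sqSubTwoSet_infinite_width (h2 : ¬ IsSquare (2 : F)) (hi : IsSquare (-1 : F)) :
    IsFSet (sqSubTwoSet F) ∧ sqSubTwoSet F ≠ monicIrreducibles F ∧
      fWidth (sqSubTwoSet F) = ⊤ := by
  refine ⟨sqSubTwoSet_isFSet h2 hi, ne_monicIrreducibles_of_natDegree_ne ?_,
    fWidth_eq_top ?_ nullity_sqSubTwoSet⟩
  · rintro f ((rfl | rfl) | ⟨n, rfl⟩)
    · rw [natDegree_X_sub_C]; norm_num
    · rw [natDegree_X_add_C]; norm_num
    · rw [sqSubTwoIterate_natDegree]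
      intro h
      rcases n with _ | n
      · simp at h
      · omega
  · refine infinite_of_natDegree_strictMono (sqSubTwoIterate F) (fun k => .inr ⟨k, rfl⟩) ?_
    simp only [sqSubTwoIterate_natDegree]
    exact pow_right_strictMono₀ (by norm_num)

theorem not_isSquare_two_of_card (h : Nat.card F % 8 = 5) :
    ¬ IsSquare (2 : F) ∧ IsSquare (-1 : F) := by
  have := Fintype.ofFinite F
  rw [Nat.card_eq_fintype_card] at h
  rw [FiniteField.isSquare_two_iff, FiniteField.isSquare_neg_one_iff]
  omega

end Dickson

/-! ### Infinite width for q ≡ 3 mod 4: divisors of x^(2^k) - a -/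

section TwoPowerDivisors

variable {F : Type*} [Field F]

theorem quadPoly_eq_mul {A B r : F} (h : r ^ 2 + A * r + B = 0) :
    quadPoly A B = (X - C r) * (X + C (A + r)) := by
  have hB : B = -(r ^ 2 + A * r) := by linear_combination h
  rw [quadPoly, hB]
  simp only [map_neg, map_add, map_mul, map_pow]
  ring

/-- With Y = x^(2^m), this is Y⁴ + AY² + b² = (Y² + b)² - (sY)². -/
theorem quadPoly_comp_X_pow_succ (A b s : F) (h : s ^ 2 = 2 * b - A) (m : ℕ) :
    (quadPoly A (b ^ 2)).comp (X ^ 2 ^ (m + 1)) =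
      (quadPoly s b).comp (X ^ 2 ^ m) * (quadPoly (-s) b).comp (X ^ 2 ^ m) := by
  have hA : A = 2 * b - s ^ 2 := by linear_combination h
  have h2 : (C 2 : F[X]) = 2 := map_ofNat C 2
  rw [quadPoly_comp_X_pow, quadPoly_comp_X_pow, quadPoly_comp_X_pow, hA, pow_succ 2 m, pow_mul]
  simp only [map_sub, map_mul, map_pow, map_neg, h2]
  ring

theorem exists_root_of_not_irreducible_quadPoly {A B : F} (h : ¬ Irreducible (quadPoly A B)) :
    ∃ r, r ^ 2 + A * r + B = 0 := by
  by_contra! hr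
  exact h (quadPoly_irreducible hr)

variable [Finite F]

/-- The product of the two numbers is the discriminant A² - 4b². Were both nonsquares, it would be a
square and the quadratic would have a root. -/
theorem isSquare_of_irreducible_quadPoly {A b : F} (h : Irreducible (quadPoly A (b ^ 2))) :
    IsSquare (2 * b - A) ∨ IsSquare (-2 * b - A) := by
  by_contra! hn
  obtain ⟨r, hr⟩ := isSquare_mul_of_not_isSquare hn.1 hn.2
  have h2 : (2 : F) ≠ 0 := Ring.two_ne_zero fun h =>
    hn.1 (FiniteField.isSquare_of_char_two h _)
  have hroot : ((-A + r) / 2) ^ 2 + A * ((-A + r) / 2) + b ^ 2 = 0 := by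
    field_simp
    linear_combination -hr
  have hdvd : X - C ((-A + r) / 2) ∣ quadPoly A (b ^ 2) :=
    quadPoly_eq_mul hroot ▸ dvd_mul_right _ _
  have := congrArg natDegree (eq_of_mem_monicIrreducibles_of_dvd
    (X_sub_C_mem_monicIrreducibles _) ⟨quadPoly_monic A (b ^ 2), h⟩ hdvd)
  simp at this

theorem quadPoly_comp_two_pow_irreducible {A B : F} (h : Irreducible (quadPoly A B))
    (hB : ¬ IsSquare B) (m : ℕ) : Irreducible ((quadPoly A B).comp (X ^ 2 ^ m)) := by
  refine irreducible_comp_of_coeff_zero Nat.prime_two (quadPoly_monic A B) h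
    (.inr (.inr (by simp))) (fun b hb => hB ⟨b, ?_⟩) m
  rw [← sq, hb]; simp

/-- Induction on m. A reducible quadratic splits into two binomials x^(2^(m+1)) + c; an irreducible
one with B = b² splits by the difference of squares, for b or -b; with B a nonsquare the whole
polynomial is irreducible. -/
theorem eq_linear_or_quadPoly_comp {f : F[X]} (hf : f ∈ monicIrreducibles F) (m : ℕ) (A B : F)
    (hd : f ∣ (quadPoly A B).comp (X ^ 2 ^ m)) :
    (∃ b, f = X - C b) ∨ ∃ (m : ℕ) (A B : F), f = (quadPoly A B).comp (X ^ 2 ^ m) := by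
  induction m generalizing A B with
  | zero =>
    rw [pow_zero, pow_one, comp_X] at hd
    by_cases h : Irreducible (quadPoly A B)
    · exact .inr ⟨0, A, B, by
        simpa using eq_of_mem_monicIrreducibles_of_dvd hf ⟨quadPoly_monic A B, h⟩ hd⟩
    · obtain ⟨r, hr⟩ := exists_root_of_not_irreducible_quadPoly h
      rw [quadPoly_eq_mul hr] at hd
      left
      rcases hf.2.prime.dvd_or_dvd hd with hd | hd
      · exact ⟨r, eq_of_mem_monicIrreducibles_of_dvd hf (X_sub_C_mem_monicIrreducibles r) hd⟩
      · refine ⟨-(A + r), ?_⟩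
        rw [eq_of_mem_monicIrreducibles_of_dvd hf (X_add_C_mem_monicIrreducibles _) hd, map_neg,
          sub_neg_eq_add]
  | succ m ih =>
    by_cases h : Irreducible (quadPoly A B)
    · by_cases hB : IsSquare B
      · obtain ⟨b, rfl⟩ := hB
        rw [← sq] at h hd
        have main : ∀ c : F, c ^ 2 = b ^ 2 → IsSquare (2 * c - A) →
            (∃ b, f = X - C b) ∨ ∃ (m : ℕ) (A B : F), f = (quadPoly A B).comp (X ^ 2 ^ m) := by
          rintro c hc ⟨s, hs⟩
          rw [← hc, quadPoly_comp_X_pow_succ A c s (by rw [hs, sq])] at hd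
          rcases hf.2.prime.dvd_or_dvd hd with hd | hd
          · exact ih _ _ hd
          · exact ih _ _ hd
        rcases isSquare_of_irreducible_quadPoly h with hs | hs
        · exact main b rfl hs
        · exact main (-b) (neg_sq b) (by simpa using hs)
      · exact .inr ⟨m + 1, A, B, eq_of_mem_monicIrreducibles_of_dvd hf
          (quadPoly_comp_mem_monicIrreducibles A B (by positivity)
            (quadPoly_comp_two_pow_irreducible h hB (m + 1))) hd⟩
    · obtain ⟨r, hr⟩ := exists_root_of_not_irreducible_quadPoly h
      -- A binomial is a quadratic in x^(2^m) without middle term, so the exponent drops and the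
      -- induction applies.
      have hY : ∀ c : F, (X : F[X]) ^ 2 ^ (m + 1) + C c = (quadPoly 0 c).comp (X ^ 2 ^ m) :=
        fun c => by rw [quadPoly_comp_X_pow, pow_succ, pow_mul]; simp
      rw [quadPoly_eq_mul hr, mul_comp, sub_comp, add_comp, X_comp, C_comp, C_comp,
        sub_eq_add_neg, ← C_neg, hY, hY] at hd
      rcases hf.2.prime.dvd_or_dvd hd with hd | hd
      · exact ih _ _ hd
      · exact ih _ _ hd

theorem eq_linear_or_quadPoly_comp_of_mem_twoPowerDivisors {f : F[X]}
    (hf : f ∈ twoPowerDivisors F) :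
    (∃ b, f = X - C b) ∨ ∃ (m : ℕ) (A B : F), f = (quadPoly A B).comp (X ^ 2 ^ m) := by
  obtain ⟨hm, _ | k, a, hd⟩ := hf
  · exact .inl ⟨a, eq_of_mem_monicIrreducibles_of_dvd hm (X_sub_C_mem_monicIrreducibles a)
      (by simpa using hd)⟩
  · refine eq_linear_or_quadPoly_comp hm k 0 (-a) ?_
    rw [quadPoly_comp_X_pow, ← pow_mul, ← pow_succ]
    simpa [sub_eq_add_neg] using hd

theorem twoPowerDivisors_isFSet : IsFSet (twoPowerDivisors F) := by
  refine ⟨fun f hf => hf.1, fun f hf g hg hd => ⟨hg, ?_⟩⟩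
  rcases eq_linear_or_quadPoly_comp_of_mem_twoPowerDivisors hf with ⟨b, rfl⟩ | ⟨m, A, B, rfl⟩
  · exact ⟨0, 0, by simpa using hd⟩
  · rw [quadPoly_comp_X_pow_sub _ _ _ (by positivity)] at hd
    rcases hg.2.prime.dvd_or_dvd hd with hd | hd
    · exact ⟨m, 0, by simpa using hd⟩
    · exact ⟨m, -A, by simpa using hd⟩

theorem exists_quadratic_extension (F : Type*) [Field F] [Finite F] :
    ∃ (E : Type) (_ : Field E) (_ : Algebra F E), Finite E ∧ Module.finrank F E = 2 := by
  obtain ⟨p, hp⟩ := CharP.exists F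
  have : Fact p.Prime := ⟨CharP.char_is_prime F p⟩
  exact ⟨FiniteField.Extension F p 2, inferInstance, inferInstance, inferInstance,
    FiniteField.finrank_extension F p 2⟩

/-- Raising a nonsquare to the odd part of |E| - 1 leaves it a nonsquare, by Euler's criterion, and
makes its order a power of 2. -/
theorem exists_pow_half_card_eq_neg_one {E : Type*} [Field E] [Fintype E]
    (hE : ringChar E ≠ 2) :
    ∃ (c : E) (s : ℕ), c ^ (Fintype.card E / 2) = -1 ∧ c ^ 2 ^ s = 1 := by
  obtain ⟨d, hd⟩ := FiniteField.exists_nonsquare hE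
  have hd0 : d ≠ 0 := by rintro rfl; exact hd .zero
  have hd1 : d ^ (Fintype.card E / 2) = -1 :=
    (FiniteField.pow_dichotomy hE hd0).resolve_left fun h =>
      hd ((FiniteField.isSquare_iff hE hd0).2 h)
  have hcard : Fintype.card E - 1 ≠ 0 := by
    have : 1 < Fintype.card E := Fintype.one_lt_card
    omega
  obtain ⟨s, r, hr, hsr⟩ := Nat.exists_eq_two_pow_mul_odd hcard
  refine ⟨d ^ r, s, ?_, ?_⟩
  · rw [← pow_mul, mul_comm, pow_mul, hd1, hr.neg_one_pow]
  · rw [← pow_mul, mul_comm, ← hsr, FiniteField.pow_card_sub_one_eq_one d hd0]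

/-- Take a nonsquare c of 2-power order in the quadratic extension, with trace T and norm N. Scaled
to rc with r = a/T, it has trace a, norm r²N and a 2-power in F, so its minimal polynomial is the
quadratic sought. This needs T ≠ 0 and N a nonsquare, and both follow from c^((q²-1)/2) = -1. -/
theorem exists_quadPoly_dvd_X_pow_sub_C (hq : Nat.card F % 4 = 3) {a : F} (ha : a ≠ 0) :
    ∃ (B : F) (s : ℕ) (e : F), Irreducible (quadPoly (-a) B) ∧ ¬ IsSquare B ∧
      quadPoly (-a) B ∣ X ^ 2 ^ s - C e := by
  obtain ⟨E, _, _, _, hrank⟩ := exists_quadratic_extension F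
  have := Fintype.ofFinite F
  have := Fintype.ofFinite E
  obtain ⟨u, hu⟩ : ∃ u, Nat.card F = 4 * u + 3 := ⟨Nat.card F / 4, by omega⟩
  have hcard : Fintype.card E = Nat.card F ^ 2 := by
    rw [Fintype.card_eq_nat_card, Module.natCard_eq_pow_finrank (K := F), hrank]
  -- (q² - 1)/2 = (q - 1)·(q + 1)/2, where (q + 1)/2 is even because q ≡ 3 mod 4.
  have hhalf : Fintype.card E / 2 = (4 * u + 2) * (2 * u + 2) := by
    rw [hcard, hu]
    have : (4 * u + 3) ^ 2 = 2 * ((4 * u + 2) * (2 * u + 2)) + 1 := by ring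
    omega
  have hE : ringChar E ≠ 2 := fun h => by
    have := FiniteField.even_card_of_char_two h
    rw [hcard, hu, Nat.pow_mod] at this
    have h3 : (4 * u + 3) % 2 = 1 := by omega
    simp [h3] at this
  have hne : (-1 : E) ≠ 1 := Ring.neg_one_ne_one_of_char_ne_two hE
  obtain ⟨c, s, hc, hcs⟩ := exists_pow_half_card_eq_neg_one hE
  rw [hhalf] at hc
  have hbase : ∀ y : F, y ≠ 0 → y ^ (4 * u + 2) = 1 := fun y hy => by
    have := FiniteField.pow_card_sub_one_eq_one y hy
    rwa [Fintype.card_eq_nat_card, hu] at this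
  have hc0 : c ≠ 0 := by
    rintro rfl
    rw [zero_pow (by positivity)] at hc
    exact neg_ne_zero.2 one_ne_zero hc.symm
  have hnot : ∀ y : F, algebraMap F E y ≠ c := by
    rintro y rfl
    have hy : y ≠ 0 := by rintro rfl; simp at hc0
    rw [← map_pow, pow_mul, hbase y hy, one_pow, map_one] at hc
    exact hne hc.symm
  have hnot' : ∀ y : F, algebraMap F E y ≠ c ^ Nat.card F := by
    intro y hy
    have hy0 : y ≠ 0 := by
      rintro rfl
      rw [map_zero] at hy
      exact pow_ne_zero _ hc0 hy.symm
    have h1 : (c ^ Nat.card F) ^ ((4 * u + 2) * (2 * u + 2)) = -1 := by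
      rw [← pow_mul, mul_comm, pow_mul, hc, Odd.neg_one_pow]
      rw [hu]; exact ⟨2 * u + 1, by ring⟩
    rw [← hy, ← map_pow, pow_mul, hbase y hy0, one_pow, map_one] at h1
    exact hne h1.symm
  have hT := FiniteField.algebraMap_trace_eq_sum_pow F E c
  have hN := FiniteField.algebraMap_norm_eq_prod_pow F E c
  rw [hrank] at hT hN
  simp only [Finset.sum_range_succ, Finset.prod_range_succ, Finset.range_zero, Finset.sum_empty,
    Finset.prod_empty, pow_zero, pow_one, zero_add, one_mul] at hT hN
  set T := Algebra.trace F E c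
  set N := Algebra.norm F c
  -- Trace zero means c^(q-1) = -1; raising to the even power (q + 1)/2 gives 1 instead of -1.
  have hT0 : T ≠ 0 := fun h => by
    rw [h, map_zero] at hT
    have h1 : c ^ (4 * u + 2) = -1 := by
      refine mul_left_cancel₀ hc0 ?_
      rw [← pow_succ', show 4 * u + 2 + 1 = Nat.card F by omega]
      linear_combination -hT
    rw [pow_mul, h1, Even.neg_one_pow ⟨u + 1, by ring⟩] at hc
    exact hne hc.symm
  -- N = c^(q+1), so N^((q-1)/2) = -1, whereas N = t² would give t^(q-1) = 1.
  have hNsq : ¬ IsSquare N := by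
    rintro ⟨t, ht⟩
    have ht0 : t ≠ 0 := by
      rintro rfl
      rw [ht, mul_zero, map_zero] at hN
      exact mul_ne_zero hc0 (pow_ne_zero _ hc0) hN.symm
    have h1 : c ^ (4 * u + 4) = algebraMap F E (t ^ 2) := by
      rw [sq, ← ht, hN, ← pow_succ', hu]
    have h2 : (c ^ (4 * u + 4)) ^ (2 * u + 1) = -1 := by
      rw [← hc, ← pow_mul]; congr 1; ring
    rw [h1, ← map_pow, ← pow_mul, show 2 * (2 * u + 1) = 4 * u + 2 by ring, hbase t ht0,
      map_one] at h2
    exact hne h2.symm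
  set r := a / T with hr
  have hr0 : r ≠ 0 := div_ne_zero ha hT0
  have hrT : a = r * T := by rw [hr]; field_simp
  have hfac : ∀ z : E, z ^ 2 - algebraMap F E a * z + algebraMap F E (r ^ 2 * N) =
      (z - algebraMap F E r * c) * (z - algebraMap F E r * c ^ Nat.card F) := fun z => by
    rw [hrT, map_mul, map_mul, map_pow, hT, hN]; ring
  have hrE : algebraMap F E r ≠ 0 := (_root_.map_ne_zero _).2 hr0
  have hirr : Irreducible (quadPoly (-a) (r ^ 2 * N)) := by
    refine quadPoly_irreducible fun x hx => ?_
    have h0 := hfac (algebraMap F E x)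
    rw [← map_pow, ← map_mul, ← map_sub, ← map_add,
      show x ^ 2 - a * x + r ^ 2 * N = 0 by linear_combination hx, map_zero] at h0
    rcases mul_eq_zero.1 h0.symm with h | h
    · exact hnot (x / r) (by rw [map_div₀, sub_eq_zero.1 h]; field_simp)
    · exact hnot' (x / r) (by rw [map_div₀, sub_eq_zero.1 h]; field_simp)
  refine ⟨r ^ 2 * N, s, r ^ 2 ^ s, hirr, ?_, ?_⟩
  · rintro ⟨t, ht⟩
    exact hNsq ⟨t / r, by field_simp; linear_combination ht⟩
  · rw [← hirr.dvd_iff_aeval_eq_zero (b := algebraMap F E r * c)]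
    · simp [mul_pow, hcs]
    · have h0 := hfac (algebraMap F E r * c)
      rw [sub_self, zero_mul] at h0
      rw [← h0]
      simp [quadPoly]; ring

theorem exists_quadPoly_comp_mem_twoPowerDivisors (hq : Nat.card F % 4 = 3) {a : F} (ha : a ≠ 0)
    (k : ℕ) : ∃ B, (quadPoly (-a) B).comp (X ^ 2 ^ k) ∈ twoPowerDivisors F := by
  obtain ⟨B, s, e, hirr, hB, hd⟩ := exists_quadPoly_dvd_X_pow_sub_C hq ha
  refine ⟨B, quadPoly_comp_mem_monicIrreducibles _ _ (by positivity)
    (quadPoly_comp_two_pow_irreducible hirr hB k), k + s, e, ?_⟩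
  have := map_dvd (compRingHom (X ^ 2 ^ k)) hd
  simpa [← pow_mul, ← pow_add] using this

/-- A divisor of x^(2^k) - a with a ≠ 0 divides g - g(0) for a member g = x^(2^(k+1)) - a x^(2^k) +
B. When a = 0 the divisor is X, which divides itself. -/
theorem nullity_twoPowerDivisors (hq : Nat.card F % 4 = 3) : nullity (twoPowerDivisors F) = ∅ := by
  refine Set.eq_empty_iff_forall_notMem.2 ?_
  rintro f ⟨hf, h⟩
  obtain ⟨hm, k, a, hd⟩ := hf
  rcases eq_or_ne a 0 with rfl | ha
  · have hX : X ∈ twoPowerDivisors F := ⟨X_mem_monicIrreducibles, 0, 0, by simp⟩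
    rw [eq_X_of_dvd_X_pow hm (by simpa using hd)] at h
    exact h X hX (by simp)
  · obtain ⟨B, hB⟩ := exists_quadPoly_comp_mem_twoPowerDivisors hq ha k
    refine h _ hB ?_
    rw [quadPoly_comp_X_pow_sub _ _ _ (by positivity), C_neg, ← sub_eq_add_neg]
    exact hd.mul_left _

theorem twoPowerDivisors_infinite_width (hq : Nat.card F % 4 = 3) :
    IsFSet (twoPowerDivisors F) ∧ twoPowerDivisors F ≠ monicIrreducibles F ∧
      fWidth (twoPowerDivisors F) = ⊤ := by
  refine ⟨twoPowerDivisors_isFSet, ne_monicIrreducibles_of_natDegree_ne fun f hf => ?_,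
    fWidth_eq_top ?_ (nullity_twoPowerDivisors hq)⟩
  · rcases eq_linear_or_quadPoly_comp_of_mem_twoPowerDivisors hf with ⟨b, rfl⟩ | ⟨m, A, B, rfl⟩
    · simp
    · rw [quadPoly_comp_X_pow_natDegree]; omega
  · choose B hB using exists_quadPoly_comp_mem_twoPowerDivisors hq (one_ne_zero (α := F))
    refine infinite_of_natDegree_strictMono _ hB ?_
    simp only [quadPoly_comp_X_pow_natDegree]
    exact (pow_right_strictMono₀ (by norm_num)).const_mul (by norm_num)

end TwoPowerDivisors

/-! ### Assembly -/

theorem pow_mod_eight_of_odd {p n : ℕ} (hp : p % 8 = 5) (hn : Odd n) : p ^ n % 8 = 5 := by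
  obtain ⟨k, rfl⟩ := hn
  rw [pow_succ, pow_mul, Nat.mul_mod, Nat.pow_mod, Nat.pow_mod p, hp]
  norm_num

theorem mainTheorem2 {F : Type*} [Field F] [Finite F] (p n q : ℕ) (hp : p.Prime)
    (hq : q = p ^ n) (hF : Nat.card F = q) :
    ((q ≠ 2 ∧ q ≠ 3) →
      ∃ (l : ℕ) (α β : F), l.Prime ∧ l ∣ q - 1 ∧
        (¬ ∃ γ : F, γ ^ l = α) ∧ (¬ ∃ γ : F, γ ^ l = β) ∧
        Irreducible (quadPoly α β) ∧
        IsFSet (quadPowerSet l α β) ∧ quadPowerSet l α β ≠ monicIrreducibles F ∧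
        fWidth (quadPowerSet l α β) = 2) ∧
    (((p % 9 = 2 ∨ p % 9 = 5) ∧ n = 1) →
      ∃ A : Set F[X], IsFSet A ∧ A ≠ monicIrreducibles F ∧ fWidth A = ⊤) ∧
    ((p % 8 = 5 ∧ Odd n) →
      ∃ A : Set F[X], IsFSet A ∧ A ≠ monicIrreducibles F ∧ fWidth A = ⊤) ∧
    (q % 4 = 3 →
      IsFSet (twoPowerDivisors F) ∧ twoPowerDivisors F ≠ monicIrreducibles F ∧
        fWidth (twoPowerDivisors F) = ⊤) := by
  subst hF
  refine ⟨fun h => exists_quadPowerSet_width_two h.1 h.2, fun h => ?_, fun h => ?_,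
    twoPowerDivisors_infinite_width⟩
  · refine ⟨_, cyclotomicThreePowerSet_infinite_width ?_⟩
    rw [hq, h.2, pow_one]
    exact h.1
  · obtain ⟨h2, hi⟩ := not_isSquare_two_of_card (F := F)
      (by rw [hq]; exact pow_mod_eight_of_odd h.1 h.2)
    exact ⟨_, sqSubTwoSet_infinite_width h2 hi⟩
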